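/- Let $m,n\ge 1$, $q=\min\{m,n\}$, $1\le k\le q$, and let $F$ be a complex $m\times n$ matrix. For a complex $m\times n$ matrix $A$ let $s_1(A)\ge\dots\ge s_q(A)\ge 0$ be its singular values (the $q$ largest eigenvalues, with multiplicity, of $(A^*A)^{1/2}$). Let $\Phi$ be a symmetric gauge function on $\mathbb{R}^q$, that is, a norm with $\Phi(x_1,\dots,x_q)=\Phi(|x_{\sigma(1)}|,\dots,|x_{\sigma(q)}|)$ for all $x\in\mathbb{R}^q$ and all permutations $\sigma$ of $\{1,\dots,q\}$, and put $\|A\|_\Phi=\Phi(s_1(A),\dots,s_q(A))$. Suppose that $\Phi$ is strictly convex: whenever $x\ne y$, $\Phi(x)=\Phi(y)=1$ and $\lambda\in(0,1)$, one has $\Phi(\lambda x+(1-\lambda)y)<1$. Let $\mathcal{I}^k_{m,n}$ be the set of complex $m\times n$ matrices $X$ of rank $k$ that are partial isometries, i.e. $\|Xf\|=\|f\|$ (Euclidean norms) for all $f\in\ker(X)^\perp$. Then a complex $m\times n$ matrix $X$ is a minimizer of $\|F-Y\|_\Phi$ over $Y\in\mathcal{I}^k_{m,n}$ (that is, $X\in\mathcal{I}^k_{m,n}$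 and $\|F-X\|_\Phi\le\|F-Y\|_\Phi$ for all $Y\in\mathcal{I}^k_{m,n}$) if and only if $$X=V\begin{bmatrix} I_k & 0\\ 0 & 0_{m-k,n-k}\end{bmatrix}W^*$$ for some unitary matrices $V$ (of size $m\times m$) and $W$ (of size $n\times n$) such that $F=V\Sigma W^*$ is a singular value decomposition of $F$, where $\Sigma$ is the $m\times n$ matrix with $\Sigma_{ii}=s_i(F)$ for $1\le i\le q$ and all other entries $0$. In particular, every minimizer has this form, and every pair $(V,W)$ giving a singular value decomposition of $F$ gives a minimizer. -/

import Mathlib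

/-- The vector `(s₁(F), …, s_q(F))`, `q = min m n`, of singular values of the complex `m × n`
matrix `F` in nonincreasing order (the index starts at `0`). -/
noncomputable def singVec {m n : ℕ} (F : Matrix (Fin m) (Fin n) ℂ) : Fin (min m n) → ℝ :=
  fun i => (Matrix.toEuclideanLin F).singularValues i

/-- `X` is a partial isometry: `‖X f‖ = ‖f‖` (Euclidean norms) for all `f ∈ (ker X)ᗮ`. -/
def IsPartialIsometry {m n : ℕ} (X : Matrix (Fin m) (Fin n) ℂ) : Prop :=
  ∀ f ∈ (LinearMap.ker (Matrix.toEuclideanLin X))ᗮ, ‖Matrix.toEuclideanLin X f‖ = ‖f‖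

/-- The set of `m × n` partial isometries of rank `k`. -/
def partialIsometries (m n k : ℕ) : Set (Matrix (Fin m) (Fin n) ℂ) :=
  {X | IsPartialIsometry X ∧ X.rank = k}

/-- A norm on `ℝ^q` (a seminorm that vanishes only at `0`) with
`Φ(x₁, …, x_q) = Φ(|x_{σ(1)}|, …, |x_{σ(q)}|)` for all permutations `σ`. -/
structure IsSymmetricGauge {q : ℕ} (Φ : Seminorm ℝ (Fin q → ℝ)) : Prop where
  eq_zero_of_map_eq_zero : ∀ x, Φ x = 0 → x = 0
  map_abs_perm : ∀ (σ : Equiv.Perm (Fin q)) (x : Fin q → ℝ), Φ x = Φ (fun i => |x (σ i)|)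

/-- Strict convexity of a norm on `ℝ^q`. -/
def IsStrictlyConvexNorm {q : ℕ} (Φ : Seminorm ℝ (Fin q → ℝ)) : Prop :=
  ∀ x y : Fin q → ℝ, x ≠ y → Φ x = 1 → Φ y = 1 →
    ∀ t : ℝ, 0 < t → t < 1 → Φ (t • x + (1 - t) • y) < 1

/-- The unitarily invariant norm `‖F‖_Φ = Φ(s₁(F), …, s_q(F))`. -/
noncomputable def gaugeNorm {m n : ℕ} (Φ : Seminorm ℝ (Fin (min m n) → ℝ))
    (F : Matrix (Fin m) (Fin n) ℂ) : ℝ :=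
  Φ (singVec F)

/-- The `m × n` matrix `Σ` with `Σ_{ii} = s_i(F)` and all other entries `0`. -/
noncomputable def sigmaMatrix {m n : ℕ} (F : Matrix (Fin m) (Fin n) ℂ) :
    Matrix (Fin m) (Fin n) ℂ :=
  Matrix.of fun i j =>
    if i.val = j.val then (((Matrix.toEuclideanLin F).singularValues i.val : ℝ) : ℂ) else 0

/-- `F = V Σ W*` is a singular value decomposition. -/
def IsSVD {m n : ℕ} (F : Matrix (Fin m) (Fin n) ℂ) (V : Matrix (Fin m) (Fin m) ℂ)
    (W : Matrix (Fin n) (Fin n) ℂ) : Prop :=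
  V ∈ Matrix.unitaryGroup (Fin m) ℂ ∧ W ∈ Matrix.unitaryGroup (Fin n) ℂ ∧
    F = V * sigmaMatrix F * W.conjTranspose

/-- The `m × n` block matrix with blocks `I_k`, `0`, `0`, `0`. -/
def idBlock (m n k : ℕ) : Matrix (Fin m) (Fin n) ℂ :=
  Matrix.of fun i j => if i.val = j.val ∧ i.val < k then 1 else 0

/-- `X` is a minimizer of `‖F - Y‖_Φ` over the partial isometries `Y` of rank `k`. -/
def IsRankMinimizer {m n : ℕ} (Φ : Seminorm ℝ (Fin (min m n) → ℝ)) (k : ℕ)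
    (F X : Matrix (Fin m) (Fin n) ℂ) : Prop :=
  X ∈ partialIsometries m n k ∧
    ∀ Y ∈ partialIsometries m n k, gaugeNorm Φ (F - X) ≤ gaugeNorm Φ (F - Y)

/-! Mirsky's theorem (`sum_truncated_singularValues_sub_le`) says that `|s(F) - s(Y)|` is weakly
majorized by `s(F - Y)`. A partial isometry of rank `k` has singular values `(1, …, 1, 0, …, 0)`,
so, symmetric gauge functions being monotone under weak majorization, `‖F - Y‖_Φ` is bounded below
by the constant `Φ(s(F) - (1, …, 1, 0, …, 0))`. Every `Y` built from a singular value decomposition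
of `F` attains it.

Conversely, for strictly convex `Φ`, equality of the norms forces `s(F - X)` to be a rearrangement
of `|s(F) - s(X)|` (`IsSymmetricGauge.le_of_truncated`). The two vectors then have equal sums of
squares, so `Re tr(X* F) = ∑ s_i(X) s_i(F)`. This is equality in von Neumann's trace inequality, and
it makes any singular value decomposition of `F + X` decompose `F` and `X` simultaneously
(`exists_simultaneous_isSVD`).

Weak majorization is used in the form `∑ max (|x_i| - t) 0 ≤ ∑ max (y_i - t) 0` for all `t ≥ 0`. It
needs no sorting of `x`, and it follows from Weyl's monotonicity by comparing traces: first for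
Hermitian matrices (Lidskii), then for rectangular ones through the Hermitian dilation. -/

/-! ### Weak majorization and symmetric gauge functions -/

theorem sum_mul_nonneg_of_antitone {q : ℕ} {c u : Fin q → ℝ} (hc : Antitone c)
    (hc0 : ∀ i, 0 ≤ c i) (hu : ∀ j, 0 ≤ ∑ i, if i ≤ j then u i else 0) :
    0 ≤ ∑ i, c i * u i := by
  induction q with
  | zero => simp
  | succ q ih =>
    -- Abel summation: split off the constant weight `c (Fin.last q)`. It multiplies the full sum of
    -- `u`; the remaining weight vanishes at the last index and is handled by induction.
    have h1 : 0 ≤ ∑ i : Fin q, (c i.castSucc - c (Fin.last q)) * u i.castSucc := by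
      refine ih (c := fun i => c i.castSucc - c (Fin.last q)) (u := fun i => u i.castSucc)
        (fun i j hij => ?_) (fun i => ?_) (fun j => ?_)
      · exact sub_le_sub_right (hc (Fin.castSucc_le_castSucc_iff.2 hij)) _
      · exact sub_nonneg.2 (hc (Fin.le_last _))
      · have h := hu j.castSucc
        rw [Fin.sum_univ_castSucc, if_neg (not_le.2 (Fin.castSucc_lt_last j)), add_zero] at h
        simpa using h
    have h2 := mul_nonneg (hc0 (Fin.last q)) (hu (Fin.last q))
    simp only [Fin.le_last, if_true] at h2
    rw [Fin.sum_univ_castSucc] at h2 ⊢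
    have h3 : ∑ i : Fin q, (c i.castSucc - c (Fin.last q)) * u i.castSucc
        = ∑ i : Fin q, c i.castSucc * u i.castSucc
          - c (Fin.last q) * ∑ i : Fin q, u i.castSucc := by
      rw [Finset.mul_sum, ← Finset.sum_sub_distrib]
      exact Finset.sum_congr rfl fun i _ => by ring
    rw [h3] at h1
    linarith

theorem exists_perm_antitone {q : ℕ} (f : Fin q → ℝ) :
    ∃ σ : Equiv.Perm (Fin q), Antitone (f ∘ σ) :=
  ⟨Tuple.sort (fun i => -f i), fun _ _ hij =>
    neg_le_neg_iff.1 (Tuple.monotone_sort (fun i => -f i) hij)⟩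

/-- Weak majorization, in the form of the truncated sums, implies inequality of the weighted sums
against any nonincreasing nonnegative weight. -/
theorem sum_mul_le_sum_mul_of_truncated {q : ℕ} {c z y : Fin q → ℝ} (hc : Antitone c)
    (hc0 : ∀ i, 0 ≤ c i) (hy : Antitone y) (hy0 : ∀ i, 0 ≤ y i)
    (h : ∀ t : ℝ, 0 ≤ t → ∑ i, max (z i - t) 0 ≤ ∑ i, max (y i - t) 0) :
    ∑ i, c i * z i ≤ ∑ i, c i * y i := by
  have key : 0 ≤ ∑ i, c i * (y i - z i) := by
    refine sum_mul_nonneg_of_antitone hc hc0 fun j => ?_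
    -- Truncating at the level `t = y j` turns the hypothesis into an inequality of partial sums:
    -- for the sorted `y` the positive terms are exactly those with `i ≤ j`, while for `z` the
    -- truncated sum dominates the partial sum.
    have h1 : ∑ i, max (y i - y j) 0 = ∑ i, if i ≤ j then y i - y j else 0 := by
      refine Finset.sum_congr rfl fun i _ => ?_
      split_ifs with hij
      · exact max_eq_left (sub_nonneg.2 (hy hij))
      · exact max_eq_right (sub_nonpos.2 (hy (not_le.1 hij).le))
    have h2 : ∑ i, (if i ≤ j then z i - y j else 0) ≤ ∑ i, max (z i - y j) 0 := by
      refine Finset.sum_le_sum fun i _ => ?_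
      split_ifs
      · exact le_max_left _ _
      · exact le_max_right _ _
    have h3 := h (y j) (hy0 j)
    have h4 : ∑ i, (if i ≤ j then y i - z i else 0)
        = ∑ i, (if i ≤ j then y i - y j else 0) - ∑ i, (if i ≤ j then z i - y j else 0) := by
      rw [← Finset.sum_sub_distrib]
      refine Finset.sum_congr rfl fun i _ => ?_
      split_ifs <;> ring
    linarith
  simp only [mul_sub, Finset.sum_sub_distrib] at key
  linarith

/-- Hahn–Banach, extending `a • z ↦ a * Φ z` from the line through `z`. -/
theorem exists_support_functional {q : ℕ} (Φ : Seminorm ℝ (Fin q → ℝ)) (z : Fin q → ℝ) :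
    ∃ c : Fin q → ℝ, ∑ i, c i * z i = Φ z ∧ ∀ w, ∑ i, c i * w i ≤ Φ w := by
  obtain ⟨g, hg, hz⟩ : ∃ g : (Fin q → ℝ) →ₗ[ℝ] ℝ, (∀ w, g w ≤ Φ w) ∧ g z = Φ z := by
    by_cases hz0 : z = 0
    · exact ⟨0, fun w => apply_nonneg _ _, by simp [hz0]⟩
    · obtain ⟨g, h1, h2⟩ := exists_extension_of_le_sublinear
        (LinearPMap.mkSpanSingleton z (Φ z) hz0) Φ
        (fun c hc x => by simp [map_smul_eq_mul, abs_of_pos hc])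
        (fun x y => map_add_le_add _ _ _) (by
          rintro ⟨x, hx⟩
          obtain ⟨a, rfl⟩ := Submodule.mem_span_singleton.1 hx
          refine (LinearPMap.mkSpanSingleton'_apply (σ := RingHom.id ℝ) z (Φ z) _ a hx).trans_le ?_
          rw [map_smul_eq_mul, RingHom.id_apply, smul_eq_mul]
          exact mul_le_mul_of_nonneg_right (le_abs_self a) (apply_nonneg _ _))
      refine ⟨g, h2, ?_⟩
      have h3 := h1 ⟨z, Submodule.mem_span_singleton_self z⟩
      rw [h3]
      exact LinearPMap.mkSpanSingleton_apply ℝ ℝ hz0 (Φ z)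
  refine ⟨fun i => g (Pi.single i 1), ?_⟩
  have hgw : ∀ w, ∑ i, g (Pi.single i 1) * w i = g w := fun w => by
    conv_rhs => rw [pi_eq_sum_univ' w, map_sum]
    refine Finset.sum_congr rfl fun i _ => ?_
    rw [map_smul, smul_eq_mul, mul_comm]
  exact ⟨by rw [hgw, hz], fun w => by rw [hgw]; exact hg w⟩

namespace IsSymmetricGauge

variable {q : ℕ} {Φ : Seminorm ℝ (Fin q → ℝ)}

theorem map_eq_of_abs_comp_perm (hΦ : IsSymmetricGauge Φ) (σ : Equiv.Perm (Fin q))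
    {x y : Fin q → ℝ} (h : ∀ i, |x i| = |y (σ i)|) : Φ x = Φ y := by
  rw [hΦ.map_abs_perm 1 x, hΦ.map_abs_perm σ y]
  simp [h]

/-- At a nonincreasing nonnegative vector a symmetric gauge function has a nonincreasing
nonnegative support functional. -/
theorem exists_antitone_support (hΦ : IsSymmetricGauge Φ) {z : Fin q → ℝ} (hz : Antitone z)
    (hz0 : ∀ i, 0 ≤ z i) :
    ∃ c : Fin q → ℝ, Antitone c ∧ (∀ i, 0 ≤ c i) ∧ ∑ i, c i * z i = Φ z ∧
      ∀ w, ∑ i, c i * w i ≤ Φ w := by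
  obtain ⟨c, hc1, hc2⟩ := exists_support_functional Φ z
  obtain ⟨σ, hσ⟩ := exists_perm_antitone fun i => |c i|
  -- The signs and the permutation can be moved from `c` onto `w`, where `Φ` does not see them.
  have hle : ∀ w, ∑ i, |c (σ i)| * w i ≤ Φ w := fun w => by
    have h1 : ∑ i, |c (σ i)| * w i
        = ∑ i, c i * (if 0 ≤ c i then w (σ.symm i) else -w (σ.symm i)) := by
      rw [← Equiv.sum_comp σ.symm]
      refine Finset.sum_congr rfl fun i _ => ?_
      rw [Equiv.apply_symm_apply]
      split_ifs with h
      · rw [abs_of_nonneg h]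
      · rw [abs_of_neg (not_le.1 h)]; ring
    rw [h1]
    refine (hc2 _).trans_eq (hΦ.map_eq_of_abs_comp_perm σ.symm fun i => ?_)
    split_ifs <;> simp
  refine ⟨fun i => |c (σ i)|, hσ, fun i => abs_nonneg _, le_antisymm (hle z) ?_, hle⟩
  rw [← hc1]
  -- Taking absolute values and sorting only increase the pairing with `z`, the second by the
  -- rearrangement inequality.
  have h1 : ∑ i, c i * z i ≤ ∑ i, |c i| * z i :=
    Finset.sum_le_sum fun i _ => mul_le_mul_of_nonneg_right (le_abs_self _) (hz0 i)
  have h2 : Monovary (fun i => |c (σ i)|) z := hσ.monovary hz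
  have h3 := h2.sum_comp_perm_mul_le_sum_mul (σ := σ.symm)
  simp only [Equiv.apply_symm_apply] at h3
  exact h1.trans h3

/-- With `c` a sorted support functional at `z`, `Φ z = ∑ c z ≤ ∑ c y ≤ Φ y`. If the ends agree, `c`
attains the norm at both vectors, hence also at the midpoint of their normalizations, which strict
convexity forbids for distinct vectors. -/
theorem le_of_truncated_aux (hΦ : IsSymmetricGauge Φ) {z y : Fin q → ℝ} (hz : Antitone z)
    (hz0 : ∀ i, 0 ≤ z i) (hy : Antitone y) (hy0 : ∀ i, 0 ≤ y i)
    (h : ∀ t : ℝ, 0 ≤ t → ∑ i, max (z i - t) 0 ≤ ∑ i, max (y i - t) 0) :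
    Φ z ≤ Φ y ∧ (IsStrictlyConvexNorm Φ → Φ y ≤ Φ z → y = z) := by
  obtain ⟨c, hc, hc0, hcz, hcw⟩ := hΦ.exists_antitone_support hz hz0
  have h1 := sum_mul_le_sum_mul_of_truncated hc hc0 hy hy0 h
  have h2 := hcw y
  refine ⟨by linarith, fun hconv hle => ?_⟩
  by_contra hne
  have heq : Φ y = Φ z := by linarith
  rcases (apply_nonneg Φ z).eq_or_lt with h0 | hpos
  · rw [hΦ.eq_zero_of_map_eq_zero z h0.symm,
      hΦ.eq_zero_of_map_eq_zero y (heq.trans h0.symm)] at hne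
    exact hne rfl
  · have hn : ∀ w, Φ w = Φ z → Φ ((Φ z)⁻¹ • w) = 1 := fun w hw => by
      rw [map_smul_eq_mul, hw, norm_inv, Real.norm_of_nonneg hpos.le, inv_mul_cancel₀ hpos.ne']
    have h3 := hconv _ _ (fun e => hne (smul_right_injective _ (inv_ne_zero hpos.ne') e))
      (hn y heq) (hn z rfl) (1 / 2) (by norm_num) (by norm_num)
    have h4 := hcw ((1 / 2 : ℝ) • (Φ z)⁻¹ • y + (1 - 1 / 2 : ℝ) • (Φ z)⁻¹ • z)
    have h5 : ∑ i, c i * ((1 / 2 : ℝ) • (Φ z)⁻¹ • y + (1 - 1 / 2 : ℝ) • (Φ z)⁻¹ • z) i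
        = (1 / 2) * (Φ z)⁻¹ * (∑ i, c i * y i + ∑ i, c i * z i) := by
      rw [← Finset.sum_add_distrib, Finset.mul_sum]
      refine Finset.sum_congr rfl fun i _ => ?_
      simp only [Pi.add_apply, Pi.smul_apply, smul_eq_mul]
      ring
    have h6 : ∑ i, c i * y i = Φ z := by linarith
    rw [h5, h6, hcz] at h4
    have h7 : (1 / 2) * (Φ z)⁻¹ * (Φ z + Φ z) = 1 := by field_simp; norm_num
    linarith

/-- Weak majorization of `|x|` by `y` implies `Φ x ≤ Φ y`; for strictly convex `Φ` equality forces
`y` to be a rearrangement of `|x|`. -/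
theorem le_of_truncated (hΦ : IsSymmetricGauge Φ) {x y : Fin q → ℝ} (hy : Antitone y)
    (hy0 : ∀ i, 0 ≤ y i)
    (h : ∀ t : ℝ, 0 ≤ t → ∑ i, max (|x i| - t) 0 ≤ ∑ i, max (y i - t) 0) :
    Φ x ≤ Φ y ∧ (IsStrictlyConvexNorm Φ → Φ y ≤ Φ x →
      ∃ σ : Equiv.Perm (Fin q), ∀ i, y i = |x (σ i)|) := by
  obtain ⟨σ, hσ⟩ := exists_perm_antitone fun i => |x i|
  have hx : Φ x = Φ (fun i => |x (σ i)|) := hΦ.map_abs_perm σ x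
  have := hΦ.le_of_truncated_aux (z := fun i => |x (σ i)|) hσ (fun i => abs_nonneg _) hy hy0
    (fun t ht => by
      rw [Equiv.sum_comp σ (fun i => max (|x i| - t) 0)]
      exact h t ht)
  rw [hx]
  exact ⟨this.1, fun hc hle => ⟨σ, fun i => congrFun (this.2 hc hle) i⟩⟩

end IsSymmetricGauge

/-- Use the sorted `|x|` itself as the weight, then `|x| y ≤ (x² + y²) / 2`. This is the Euclidean
case needed for von Neumann's inequality. -/
theorem sum_sq_le_of_truncated {q : ℕ} {x y : Fin q → ℝ} (hy : Antitone y) (hy0 : ∀ i, 0 ≤ y i)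
    (h : ∀ t : ℝ, 0 ≤ t → ∑ i, max (|x i| - t) 0 ≤ ∑ i, max (y i - t) 0) :
    ∑ i, x i ^ 2 ≤ ∑ i, y i ^ 2 := by
  obtain ⟨σ, hσ⟩ := exists_perm_antitone fun i => |x i|
  have h1 := sum_mul_le_sum_mul_of_truncated (c := fun i => |x (σ i)|) (z := fun i => |x (σ i)|)
    hσ (fun i => abs_nonneg _) hy hy0 (fun t ht => by
      rw [Equiv.sum_comp σ (fun i => max (|x i| - t) 0)]
      exact h t ht)
  have h2 : ∑ i, |x (σ i)| * |x (σ i)| = ∑ i, x i ^ 2 := by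
    rw [Equiv.sum_comp σ (fun i => |x i| * |x i|)]
    exact Finset.sum_congr rfl fun i _ => by rw [abs_mul_abs_self, sq]
  have h3 : ∑ i, |x (σ i)| * y i ≤ ∑ i, (|x (σ i)| * |x (σ i)| + y i ^ 2) / 2 :=
    Finset.sum_le_sum fun i _ => by nlinarith [sq_nonneg (|x (σ i)| - y i)]
  rw [← Finset.sum_div, Finset.sum_add_distrib] at h3
  linarith

/-! ### Eigenvalue inequalities for Hermitian matrices: Weyl and Lidskii -/

open Matrix
open scoped ComplexOrder

section Hermitian

variable {ι : Type*} [Fintype ι] [DecidableEq ι]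

/-- The Hermitian matrix `U diag(α) U*`. -/
noncomputable def conjDiagonal (U : Matrix ι ι ℂ) (α : ι → ℝ) : Matrix ι ι ℂ :=
  U * diagonal (fun i => (α i : ℂ)) * Uᴴ

theorem unitary_conjTranspose_mul {U : Matrix ι ι ℂ} (hU : U ∈ unitaryGroup ι ℂ) : Uᴴ * U = 1 :=
  mem_unitaryGroup_iff'.1 hU

theorem unitary_mul_conjTranspose {U : Matrix ι ι ℂ} (hU : U ∈ unitaryGroup ι ℂ) : U * Uᴴ = 1 :=
  mem_unitaryGroup_iff.1 hU

theorem conjDiagonal_add (U : Matrix ι ι ℂ) (α β : ι → ℝ) :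
    conjDiagonal U α + conjDiagonal U β = conjDiagonal U (α + β) := by
  simp only [conjDiagonal, ← Matrix.add_mul, ← Matrix.mul_add, diagonal_add, Pi.add_apply,
    Complex.ofReal_add]

theorem conjDiagonal_sub (U : Matrix ι ι ℂ) (α β : ι → ℝ) :
    conjDiagonal U α - conjDiagonal U β = conjDiagonal U (α - β) := by
  simp only [conjDiagonal, ← Matrix.sub_mul, ← Matrix.mul_sub, diagonal_sub, Pi.sub_apply,
    Complex.ofReal_sub]

theorem conjDiagonal_const {U : Matrix ι ι ℂ} (hU : U ∈ unitaryGroup ι ℂ) (t : ℝ) :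
    conjDiagonal U (fun _ => t) = diagonal fun _ => (t : ℂ) := by
  rw [conjDiagonal, ← Matrix.smul_one_eq_diagonal, Matrix.mul_smul, Matrix.mul_one,
    Matrix.smul_mul, unitary_mul_conjTranspose hU]

theorem posSemidef_conjDiagonal (U : Matrix ι ι ℂ) {α : ι → ℝ} (hα : ∀ i, 0 ≤ α i) :
    (conjDiagonal U α).PosSemidef :=
  (PosSemidef.diagonal fun i => by simpa using hα i).mul_mul_conjTranspose_same U

theorem isHermitian_conjDiagonal (U : Matrix ι ι ℂ) (α : ι → ℝ) :
    (conjDiagonal U α).IsHermitian :=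
  isHermitian_mul_mul_conjTranspose U
    (isHermitian_diagonal_of_self_adjoint _ (funext fun _ => Complex.conj_ofReal _))

theorem trace_conjDiagonal {U : Matrix ι ι ℂ} (hU : U ∈ unitaryGroup ι ℂ) (α : ι → ℝ) :
    (conjDiagonal U α).trace = ((∑ i, α i : ℝ) : ℂ) := by
  rw [conjDiagonal, trace_mul_comm, ← Matrix.mul_assoc, unitary_conjTranspose_mul hU,
    Matrix.one_mul, trace_diagonal, Complex.ofReal_sum]

theorem dotProduct_conjDiagonal_mulVec (U : Matrix ι ι ℂ) (α : ι → ℝ) (v : ι → ℂ) :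
    star v ⬝ᵥ (conjDiagonal U α *ᵥ v) = ((∑ i, α i * Complex.normSq ((Uᴴ *ᵥ v) i) : ℝ) : ℂ) := by
  rw [conjDiagonal, ← mulVec_mulVec, ← mulVec_mulVec, dotProduct_mulVec]
  have h : star v ᵥ* U = star (Uᴴ *ᵥ v) := by rw [star_mulVec, conjTranspose_conjTranspose]
  rw [h, dotProduct, Complex.ofReal_sum]
  refine Finset.sum_congr rfl fun i _ => ?_
  rw [mulVec_diagonal, Pi.star_apply, Complex.ofReal_mul, Complex.normSq_eq_conj_mul_self,
    Complex.star_def]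
  ring

theorem sum_normSq_conjTranspose_mulVec {U : Matrix ι ι ℂ} (hU : U ∈ unitaryGroup ι ℂ)
    (v : ι → ℂ) :
    ∑ i, Complex.normSq ((Uᴴ *ᵥ v) i) = ∑ i, Complex.normSq (v i) := by
  have h1 := dotProduct_conjDiagonal_mulVec U (fun _ => 1) v
  have h2 := dotProduct_conjDiagonal_mulVec (1 : Matrix ι ι ℂ) (fun _ => 1) v
  rw [conjDiagonal_const hU] at h1
  rw [conjDiagonal_const (one_mem _), h1] at h2
  simpa using Complex.ofReal_injective h2

/-- Weyl's monotonicity principle. -/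
theorem le_of_posSemidef_conjDiagonal_sub {N : ℕ} (e : ι ≃ Fin N) {U U' : Matrix ι ι ℂ}
    (hU : U ∈ unitaryGroup ι ℂ) (hU' : U' ∈ unitaryGroup ι ℂ) {α β : ι → ℝ}
    (hα : ∀ i j, e i ≤ e j → α j ≤ α i) (hβ : ∀ i j, e i ≤ e j → β j ≤ β i)
    (h : (conjDiagonal U' β - conjDiagonal U α).PosSemidef) (i : ι) : α i ≤ β i := by
  let S := {j // e j ≤ e i}
  let T := {j // e j < e i}
  -- Dimension count: `S` contains `i` and `T` does not, so some nonzero combination of the columns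
  -- of `U` indexed by `S` is orthogonal to the columns of `U'` indexed by `T`. On this vector the
  -- form of `α` is at least `α i` and that of `β` at most `β i` times the squared norm.
  let L : (S → ℂ) →ₗ[ℂ] (T → ℂ) :=
    Matrix.toLin' ((U'ᴴ * U).submatrix Subtype.val Subtype.val)
  have hker : LinearMap.ker L ≠ ⊥ := by
    refine LinearMap.ker_ne_bot_of_finrank_lt ?_
    rw [Module.finrank_fintype_fun_eq_card, Module.finrank_fintype_fun_eq_card]
    rw [Fintype.card_subtype, Fintype.card_subtype]
    refine Finset.card_lt_card (Finset.ssubset_iff_of_subset ?_ |>.2 ⟨i, by simp, by simp⟩)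
    exact Finset.monotone_filter_right _ fun j _ hj => le_of_lt hj
  obtain ⟨u, hu, hu0⟩ := (Submodule.ne_bot_iff _).1 hker
  let w : ι → ℂ := fun j => if hj : e j ≤ e i then u ⟨j, hj⟩ else 0
  have hw : ∀ j, ¬ e j ≤ e i → w j = 0 := fun j hj => dif_neg hj
  have hUw : Uᴴ *ᵥ (U *ᵥ w) = w := by
    rw [mulVec_mulVec, unitary_conjTranspose_mul hU, one_mulVec]
  have hw' : ∀ j, e j < e i → (U'ᴴ *ᵥ (U *ᵥ w)) j = 0 := fun j hj => by
    have h1 := congrFun (LinearMap.mem_ker.1 hu) ⟨j, hj⟩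
    rw [mulVec_mulVec]
    have h2 : ((U'ᴴ * U) *ᵥ w) j = ∑ s : S, (U'ᴴ * U) j s.1 * u s := by
      rw [mulVec, dotProduct, ← Fintype.sum_subtype_add_sum_subtype (fun k => e k ≤ e i)]
      rw [Finset.sum_eq_zero (s := (Finset.univ : Finset {k // ¬ e k ≤ e i}))
        fun k _ => by rw [hw k.1 k.2, mul_zero], add_zero]
      refine Finset.sum_congr rfl fun s _ => ?_
      rw [show w s.1 = u s from dif_pos s.2]
    rw [h2]
    exact h1
  have hpos : 0 < ∑ j, Complex.normSq (w j) := by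
    obtain ⟨s, hs⟩ := Function.ne_iff.1 hu0
    refine Finset.sum_pos' (fun j _ => Complex.normSq_nonneg _)
      ⟨s.1, Finset.mem_univ _, Complex.normSq_pos.2 ?_⟩
    have : w s.1 = u s := dif_pos s.2
    rw [this]
    exact hs
  have hq := h.dotProduct_mulVec_nonneg (U *ᵥ w)
  rw [sub_mulVec, dotProduct_sub, dotProduct_conjDiagonal_mulVec, dotProduct_conjDiagonal_mulVec,
    hUw, ← Complex.ofReal_sub, Complex.zero_le_real, sub_nonneg] at hq
  have h1 : α i * ∑ j, Complex.normSq (w j) ≤ ∑ j, α j * Complex.normSq (w j) := by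
    rw [Finset.mul_sum]
    refine Finset.sum_le_sum fun j _ => ?_
    by_cases hj : e j ≤ e i
    · exact mul_le_mul_of_nonneg_right (hα _ _ hj) (Complex.normSq_nonneg _)
    · simp [hw j hj]
  have h2 : ∑ j, β j * Complex.normSq ((U'ᴴ *ᵥ (U *ᵥ w)) j)
      ≤ β i * ∑ j, Complex.normSq ((U'ᴴ *ᵥ (U *ᵥ w)) j) := by
    rw [Finset.mul_sum]
    refine Finset.sum_le_sum fun j _ => ?_
    by_cases hj : e j < e i
    · simp [hw' j hj]
    · exact mul_le_mul_of_nonneg_right (hβ _ _ (not_lt.1 hj)) (Complex.normSq_nonneg _)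
  have h3 : ∑ j, Complex.normSq ((U'ᴴ *ᵥ (U *ᵥ w)) j) = ∑ j, Complex.normSq (w j) := by
    rw [sum_normSq_conjTranspose_mulVec hU', ← sum_normSq_conjTranspose_mulVec hU, hUw]
  rw [h3] at h2
  exact le_of_mul_le_mul_right (h1.trans (hq.trans h2)) hpos

theorem Matrix.IsHermitian.exists_conjDiagonal_sorted {N : ℕ} (e : ι ≃ Fin N) {M : Matrix ι ι ℂ}
    (hM : M.IsHermitian) :
    ∃ U ∈ unitaryGroup ι ℂ, ∃ μ : ι → ℝ, (∀ i j, e i ≤ e j → μ j ≤ μ i) ∧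
      M = conjDiagonal U μ := by
  obtain ⟨σ, hσ⟩ := exists_perm_antitone (hM.eigenvalues ∘ e.symm)
  let τ : Equiv.Perm ι := (e.trans σ).trans e.symm
  let U : Matrix ι ι ℂ := hM.eigenvectorUnitary
  have hU : U ∈ unitaryGroup ι ℂ := hM.eigenvectorUnitary.2
  have hUτ : U.submatrix id τ * (U.submatrix id τ)ᴴ = 1 := by
    rw [conjTranspose_submatrix, submatrix_mul_equiv, unitary_mul_conjTranspose hU, submatrix_id_id]
  refine ⟨U.submatrix id τ, mem_unitaryGroup_iff.2 hUτ, hM.eigenvalues ∘ τ, fun i j hij => ?_, ?_⟩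
  · simpa [τ] using hσ hij
  · have h1 : (diagonal fun i => ((hM.eigenvalues ∘ τ) i : ℂ))
        = (diagonal fun i => (hM.eigenvalues i : ℂ)).submatrix τ τ :=
      (submatrix_diagonal_equiv (fun i => (hM.eigenvalues i : ℂ)) τ).symm
    rw [conjDiagonal, h1, conjTranspose_submatrix, submatrix_mul_equiv, submatrix_mul_equiv,
      submatrix_id_id]
    exact hM.spectral_theorem

/-- Lidskii's inequality for the truncated sums. -/
theorem sum_truncated_eigenvalues_sub_le {N : ℕ} (e : ι ≃ Fin N) {U₁ U₂ U₃ : Matrix ι ι ℂ}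
    (h₁ : U₁ ∈ unitaryGroup ι ℂ) (h₂ : U₂ ∈ unitaryGroup ι ℂ) (h₃ : U₃ ∈ unitaryGroup ι ℂ)
    {α β γ : ι → ℝ} (hα : ∀ i j, e i ≤ e j → α j ≤ α i) (hβ : ∀ i j, e i ≤ e j → β j ≤ β i)
    (h : conjDiagonal U₁ α - conjDiagonal U₂ β = conjDiagonal U₃ γ) (t : ℝ) :
    ∑ i, max (α i - β i - t) 0 ≤ ∑ i, max (γ i - t) 0 := by
  -- Write `A`, `B`, `C = A - B` for the three matrices. With `P` the positive part of `C - t`, `M =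
  -- B + P` satisfies `M ≥ B` and `M + t ≥ A`. Weyl gives `max (α - β - t) 0 ≤ μ - β` entrywise, and
  -- the right side sums to the trace of `P`.
  set p : ι → ℝ := fun i => max (γ i - t) 0 with hp
  have hM : (conjDiagonal U₂ β + conjDiagonal U₃ p).IsHermitian :=
    (isHermitian_conjDiagonal _ _).add (isHermitian_conjDiagonal _ _)
  obtain ⟨U, hU, μ, hμ, hMμ⟩ := hM.exists_conjDiagonal_sorted e
  have hβμ : ∀ i, β i ≤ μ i := by
    refine le_of_posSemidef_conjDiagonal_sub e h₂ hU hβ hμ ?_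
    rw [← hMμ, add_sub_cancel_left]
    exact posSemidef_conjDiagonal _ fun i => le_max_right _ _
  have hαμ : ∀ i, α i ≤ μ i + t := by
    refine le_of_posSemidef_conjDiagonal_sub e h₁ hU (β := μ + fun _ => t) hα
      (fun i j hij => add_le_add_left (hμ i j hij) t) ?_
    have h4 : conjDiagonal U (μ + fun _ => t) - conjDiagonal U₁ α
        = conjDiagonal U₃ (p + (fun _ => t) - γ) := by
      rw [← conjDiagonal_add, ← hMμ, conjDiagonal_const hU, ← conjDiagonal_const h₃,
        ← conjDiagonal_sub, ← conjDiagonal_add, ← h]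
      abel
    rw [h4]
    refine posSemidef_conjDiagonal _ fun i => ?_
    have := le_max_left (γ i - t) 0
    simp only [Pi.add_apply, Pi.sub_apply, hp]
    linarith
  have htr : ∑ i, μ i = ∑ i, β i + ∑ i, p i := by
    have := congrArg trace hMμ
    rw [trace_add, trace_conjDiagonal h₂, trace_conjDiagonal h₃, trace_conjDiagonal hU] at this
    exact_mod_cast this.symm
  have : ∑ i, max (α i - β i - t) 0 ≤ ∑ i, (μ i - β i) := by
    refine Finset.sum_le_sum fun i _ => max_le ?_ (sub_nonneg.2 (hβμ i))
    have := hαμ i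
    linarith
  rw [Finset.sum_sub_distrib] at this
  linarith

end Hermitian

/-! ### Arithmetic of rectangular diagonal matrices -/

/-- The rectangular diagonal matrix with diagonal entries `d 0, d 1, …`. -/
noncomputable def rectDiagonal (m n : ℕ) (d : ℕ → ℝ) : Matrix (Fin m) (Fin n) ℂ :=
  Matrix.of fun i j => if i.val = j.val then (d i.val : ℂ) else 0

section RectDiagonal

variable {m n p : ℕ}

theorem rectDiagonal_apply (d : ℕ → ℝ) (i : Fin m) (j : Fin n) :
    rectDiagonal m n d i j = if i.val = j.val then (d i.val : ℂ) else 0 := rfl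

theorem rectDiagonal_congr {d d' : ℕ → ℝ} (h : ∀ i, i < m → i < n → d i = d' i) :
    rectDiagonal m n d = rectDiagonal m n d' := by
  ext i j
  rw [rectDiagonal_apply, rectDiagonal_apply]
  split_ifs with hij
  · rw [h i i.2 (hij ▸ j.2)]
  · rfl

theorem rectDiagonal_conjTranspose (d : ℕ → ℝ) :
    (rectDiagonal m n d)ᴴ = rectDiagonal n m d := by
  ext i j
  rw [conjTranspose_apply, rectDiagonal_apply, rectDiagonal_apply]
  split_ifs with h1 h2 h2
  · rw [h1, Complex.star_def, Complex.conj_ofReal]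
  · exact absurd h1.symm h2
  · exact absurd h2.symm h1
  · simp

theorem rectDiagonal_mul (d d' : ℕ → ℝ) :
    rectDiagonal m n d * rectDiagonal n p d'
      = rectDiagonal m p fun i => if i < n then d i * d' i else 0 := by
  ext i j
  rw [mul_apply, rectDiagonal_apply]
  by_cases hi : i.val < n
  · rw [Finset.sum_eq_single ⟨i, hi⟩]
    · simp only [rectDiagonal_apply, if_true, hi]
      split_ifs <;> simp
    · intro k _ hk
      rw [rectDiagonal_apply, if_neg fun h => hk (Fin.ext h.symm), zero_mul]
    · simp
  · rw [Finset.sum_eq_zero]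
    · simp [hi]
    · intro k _
      rw [rectDiagonal_apply, if_neg fun h => hi (lt_of_eq_of_lt h k.2), zero_mul]

theorem rectDiagonal_add (d d' : ℕ → ℝ) :
    rectDiagonal m n d + rectDiagonal m n d' = rectDiagonal m n (fun i => d i + d' i) := by
  ext i j
  simp only [Matrix.add_apply, rectDiagonal_apply]
  split_ifs <;> simp

theorem rectDiagonal_sub (d d' : ℕ → ℝ) :
    rectDiagonal m n d - rectDiagonal m n d' = rectDiagonal m n (fun i => d i - d' i) := by
  ext i j
  simp only [Matrix.sub_apply, rectDiagonal_apply]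
  split_ifs <;> simp

theorem rectDiagonal_self (d : ℕ → ℝ) :
    rectDiagonal m m d = diagonal fun i : Fin m => (d i : ℂ) := by
  ext i j
  simp only [rectDiagonal_apply, diagonal_apply, Fin.ext_iff]

theorem rectDiagonal_one : rectDiagonal m m (fun _ => 1) = 1 := by
  rw [rectDiagonal_self, ← diagonal_one]
  simp

theorem rectDiagonal_zero : rectDiagonal m n (fun _ => 0) = 0 := by
  ext i j
  simp [rectDiagonal_apply]

end RectDiagonal

/-! ### Hermitian dilation and Mirsky's theorem -/

section Dilation

variable {m n : ℕ}

/-- The Hermitian dilation of a rectangular matrix. -/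
def dilation (A : Matrix (Fin m) (Fin n) ℂ) : Matrix (Fin m ⊕ Fin n) (Fin m ⊕ Fin n) ℂ :=
  fromBlocks 0 A Aᴴ 0

theorem dilation_sub (A B : Matrix (Fin m) (Fin n) ℂ) :
    dilation A - dilation B = dilation (A - B) := by
  simp [dilation, sub_eq_add_neg, fromBlocks_neg, fromBlocks_add, conjTranspose_add]

/-- The eigenvector matrix of the dilation of a rectangular diagonal matrix. -/
noncomputable def dilationEigenvectors (m n : ℕ) :
    Matrix (Fin m ⊕ Fin n) (Fin m ⊕ Fin n) ℂ :=
  fromBlocks (rectDiagonal m m fun i => if i < n then (√2)⁻¹ else 1)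
    (rectDiagonal m n fun _ => (√2)⁻¹) (rectDiagonal n m fun _ => (√2)⁻¹)
    (rectDiagonal n n fun i => if i < m then -(√2)⁻¹ else -1)

theorem inv_sqrt_two_mul_self : (√2 : ℝ)⁻¹ * (√2)⁻¹ = 1 / 2 := by
  rw [← mul_inv, Real.mul_self_sqrt zero_le_two, one_div]

theorem dilationEigenvectors_conjTranspose :
    (dilationEigenvectors m n)ᴴ = dilationEigenvectors m n := by
  simp only [dilationEigenvectors, fromBlocks_conjTranspose, rectDiagonal_conjTranspose]

theorem dilationEigenvectors_mul_self :
    dilationEigenvectors m n * dilationEigenvectors m n = 1 := by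
  have h := inv_sqrt_two_mul_self
  simp only [dilationEigenvectors, fromBlocks_multiply, rectDiagonal_mul, rectDiagonal_add]
  rw [← fromBlocks_one, ← rectDiagonal_one, ← rectDiagonal_one, ← rectDiagonal_zero,
    ← rectDiagonal_zero]
  congr 1 <;> refine rectDiagonal_congr fun i h1 h2 => ?_ <;> simp only [h1, h2, if_true] <;>
    (try split_ifs) <;> linarith

/-- The eigenvalues of the dilation of a matrix with singular values `a`. -/
def dilationEigenvalues (m n : ℕ) (a : ℕ → ℝ) : Fin m ⊕ Fin n → ℝ :=
  Sum.elim (fun i => a i) (fun j => -a j)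

/-- For `i < min m n` the dilation acts as the block `[[0, a i], [a i, 0]]`, with eigenvectors `(1,
±1) / √2` and eigenvalues `± a i`. The remaining basis vectors lie in the kernel, which matches `a i
= 0`. -/
theorem dilation_rectDiagonal_mul {a : ℕ → ℝ} (ha : ∀ i, min m n ≤ i → a i = 0) :
    dilation (rectDiagonal m n a) * dilationEigenvectors m n
      = dilationEigenvectors m n * diagonal fun i => (dilationEigenvalues m n a i : ℂ) := by
  have hD : (diagonal fun i => (dilationEigenvalues m n a i : ℂ))
      = fromBlocks (rectDiagonal m m a) 0 0 (rectDiagonal n n fun i => -a i) := by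
    rw [rectDiagonal_self, rectDiagonal_self, fromBlocks_diagonal]
    congr 1
    ext i
    cases i <;> rfl
  rw [hD]
  simp only [dilation, dilationEigenvectors, fromBlocks_multiply, rectDiagonal_mul,
    rectDiagonal_conjTranspose, Matrix.zero_mul, Matrix.mul_zero, zero_add, add_zero]
  congr 1 <;> refine rectDiagonal_congr fun i h1 h2 => ?_ <;> simp only [h1, h2, if_true] <;>
    (try split_ifs) <;> first | (rw [ha i (by omega)]; simp) | ring

/-- `A = V diag(a) W*` with `V`, `W` unitary and `a` nonincreasing, nonnegative and supported
on `i < min m n`. -/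
structure IsSingularDecomposition (A : Matrix (Fin m) (Fin n) ℂ) (a : ℕ → ℝ)
    (V : Matrix (Fin m) (Fin m) ℂ) (W : Matrix (Fin n) (Fin n) ℂ) : Prop where
  left_mem : V ∈ unitaryGroup (Fin m) ℂ
  right_mem : W ∈ unitaryGroup (Fin n) ℂ
  eq : A = V * rectDiagonal m n a * Wᴴ
  antitone : Antitone a
  nonneg : ∀ i, 0 ≤ a i
  eq_zero : ∀ i, min m n ≤ i → a i = 0

theorem IsSingularDecomposition.exists_dilation_eq {A : Matrix (Fin m) (Fin n) ℂ} {a : ℕ → ℝ}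
    {V : Matrix (Fin m) (Fin m) ℂ} {W : Matrix (Fin n) (Fin n) ℂ}
    (h : IsSingularDecomposition A a V W) :
    ∃ U ∈ unitaryGroup (Fin m ⊕ Fin n) ℂ,
      dilation A = conjDiagonal U (dilationEigenvalues m n a) := by
  set R := dilationEigenvectors m n with hR
  set K : Matrix (Fin m ⊕ Fin n) (Fin m ⊕ Fin n) ℂ := fromBlocks V 0 0 W with hK
  have hK1 : K * Kᴴ = 1 := by
    simp [hK, fromBlocks_conjTranspose, fromBlocks_multiply, unitary_mul_conjTranspose h.left_mem,
      unitary_mul_conjTranspose h.right_mem]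
  have hRR : R * R = 1 := dilationEigenvectors_mul_self
  have hRc : Rᴴ = R := dilationEigenvectors_conjTranspose
  refine ⟨K * R, mem_unitaryGroup_iff.2 ?_, ?_⟩
  · rw [star_eq_conjTranspose, conjTranspose_mul, hRc, Matrix.mul_assoc, ← Matrix.mul_assoc R, hRR,
      Matrix.one_mul, hK1]
  · have h1 : dilation A = K * dilation (rectDiagonal m n a) * Kᴴ := by
      rw [h.eq]
      simp [dilation, hK, fromBlocks_conjTranspose, fromBlocks_multiply, conjTranspose_mul,
        Matrix.mul_assoc]
    rw [h1, conjDiagonal, conjTranspose_mul, hRc, Matrix.mul_assoc K R, ← dilation_rectDiagonal_mul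
      h.eq_zero, ← hR, ← Matrix.mul_assoc, ← Matrix.mul_assoc, Matrix.mul_assoc (K * _) R R, hRR,
      Matrix.mul_one]

/-- An enumeration of `Fin m ⊕ Fin n` along which the dilation eigenvalues are nonincreasing. -/
def dilationOrder (m n : ℕ) : Fin m ⊕ Fin n ≃ Fin (m + n) :=
  (Equiv.sumCongr (Equiv.refl _) Fin.revPerm).trans finSumFinEquiv

theorem dilationEigenvalues_sorted {a : ℕ → ℝ} (ha : Antitone a) (ha0 : ∀ i, 0 ≤ a i)
    (i j : Fin m ⊕ Fin n) (hij : dilationOrder m n i ≤ dilationOrder m n j) :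
    dilationEigenvalues m n a j ≤ dilationEigenvalues m n a i := by
  rcases i with i | i <;> rcases j with j | j <;>
    simp only [dilationOrder, Equiv.trans_apply, Equiv.sumCongr_apply, Sum.map_inl, Sum.map_inr,
      finSumFinEquiv_apply_left, finSumFinEquiv_apply_right, Fin.le_def, Fin.val_castAdd,
      Fin.val_natAdd, Equiv.refl_apply, Fin.revPerm_apply, Fin.val_rev] at hij <;>
    simp only [dilationEigenvalues, Sum.elim_inl, Sum.elim_inr]
  · exact ha hij
  · linarith [ha0 i, ha0 j]
  · omega
  · exact neg_le_neg (ha (by omega))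

theorem sum_fin_eq_sum_fin_min {f : ℕ → ℝ} (hf : ∀ i, min m n ≤ i → f i = 0) :
    ∑ i : Fin m, f i = ∑ i : Fin (min m n), f i ∧ ∑ i : Fin n, f i = ∑ i : Fin (min m n), f i := by
  constructor <;>
  · rw [Fin.sum_univ_eq_sum_range f, Fin.sum_univ_eq_sum_range f]
    refine (Finset.sum_subset (Finset.range_mono (by simp)) fun i _ hi => hf i ?_).symm
    simpa only [Finset.mem_range, not_lt] using hi

/-- Mirsky's theorem, as weak majorization of `|s(A) - s(B)|` by `s(A - B)`. -/
theorem sum_truncated_singularValues_sub_le {A B : Matrix (Fin m) (Fin n) ℂ} {a b c : ℕ → ℝ}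
    {V₁ V₂ V₃ : Matrix (Fin m) (Fin m) ℂ} {W₁ W₂ W₃ : Matrix (Fin n) (Fin n) ℂ}
    (hA : IsSingularDecomposition A a V₁ W₁) (hB : IsSingularDecomposition B b V₂ W₂)
    (hC : IsSingularDecomposition (A - B) c V₃ W₃) {t : ℝ} (ht : 0 ≤ t) :
    ∑ i : Fin (min m n), max (|a i - b i| - t) 0 ≤ ∑ i : Fin (min m n), max (c i - t) 0 := by
  obtain ⟨U₁, hU₁, h₁⟩ := hA.exists_dilation_eq
  obtain ⟨U₂, hU₂, h₂⟩ := hB.exists_dilation_eq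
  obtain ⟨U₃, hU₃, h₃⟩ := hC.exists_dilation_eq
  have h := sum_truncated_eigenvalues_sub_le (dilationOrder m n) hU₁ hU₂ hU₃
    (dilationEigenvalues_sorted hA.antitone hA.nonneg)
    (dilationEigenvalues_sorted hB.antitone hB.nonneg)
    (by rw [← h₁, ← h₂, ← h₃, dilation_sub]) t
  simp only [Fintype.sum_sum_type, dilationEigenvalues, Sum.elim_inl, Sum.elim_inr] at h
  -- Since `t ≥ 0`, the padding zeros beyond `min m n` and the negative eigenvalues `-c j`
  -- contribute nothing.
  have e1 := (sum_fin_eq_sum_fin_min (m := m) (n := n) (f := fun i => max (a i - b i - t) 0)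
    fun i hi => by simp [hA.eq_zero i hi, hB.eq_zero i hi, ht]).1
  have e2 := (sum_fin_eq_sum_fin_min (m := m) (n := n) (f := fun i => max (-a i - -b i - t) 0)
    fun i hi => by simp [hA.eq_zero i hi, hB.eq_zero i hi, ht]).2
  have e3 := (sum_fin_eq_sum_fin_min (m := m) (n := n) (f := fun i => max (c i - t) 0)
    fun i hi => by simp [hC.eq_zero i hi, ht]).1
  have e4 : ∑ j : Fin n, max (-c j - t) 0 = 0 := Finset.sum_eq_zero fun j _ =>
    max_eq_right (by linarith [hC.nonneg j])
  rw [e1, e2, e3, e4, add_zero, ← Finset.sum_add_distrib] at h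
  -- The two halves of the spectrum supply `a i - b i` and `b i - a i`; one of them is `|a i - b
  -- i|`.
  refine le_trans (Finset.sum_le_sum fun i _ => ?_) h
  rcases abs_cases (a i - b i) with ⟨h5, _⟩ | ⟨h5, _⟩ <;> rw [h5]
  · exact le_add_of_nonneg_right (le_max_right _ _)
  · rw [show -(a i - b i) = -a i - -b i by ring]
    exact le_add_of_nonneg_left (le_max_right _ _)

end Dilation

/-! ### Singular value decompositions and their uniqueness -/

theorem exists_equiv_of_multiset_map_eq {ι R : Type*} [Fintype ι] [DecidableEq R] {f g : ι → R}
    (h : Multiset.map f Finset.univ.val = Multiset.map g Finset.univ.val) :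
    ∃ σ : Equiv.Perm ι, ∀ i, f i = g (σ i) := by
  have e : ∀ c, Nonempty ({a // f a = c} ≃ {b // g b = c}) := fun c => by
    refine Fintype.card_eq.1 ?_
    have := congrArg (Multiset.count c) h
    rw [Multiset.count_map, Multiset.count_map] at this
    rw [Fintype.card_subtype, Fintype.card_subtype]
    simp only [eq_comm (a := c)] at this
    exact this
  exact ⟨Equiv.ofFiberEquiv fun c => (e c).some, fun i =>
    (Equiv.ofFiberEquiv_map (fun c => (e c).some) i).symm⟩

section SingularValues

variable {m n : ℕ}

theorem finrank_range_toEuclideanLin (A : Matrix (Fin m) (Fin n) ℂ) :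
    Module.finrank ℂ (LinearMap.range (Matrix.toEuclideanLin A)) = A.rank := by
  have h : Matrix.toEuclideanLin A =
      toLin (PiLp.basisFun 2 ℂ (Fin n)) (PiLp.basisFun 2 ℂ (Fin m)) A :=
    DFunLike.congr_fun (toLpLin_eq_toLin (R := ℂ) 2 2) A
  rw [h]
  exact (A.rank_eq_finrank_range_toLin _ _).symm

/-- The orthonormal eigenbasis of `A* A` for the squares of the singular values. -/
theorem exists_rightSingularBasis (A : Matrix (Fin m) (Fin n) ℂ) :
    ∃ b : OrthonormalBasis (Fin n) ℂ (EuclideanSpace ℂ (Fin n)), ∀ i,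
      LinearMap.adjoint (Matrix.toEuclideanLin A) (Matrix.toEuclideanLin A (b i))
        = (((Matrix.toEuclideanLin A).singularValues i ^ 2 : ℝ) : ℂ) • b i := by
  set T := Matrix.toEuclideanLin A
  have hn : Module.finrank ℂ (EuclideanSpace ℂ (Fin n)) = n := finrank_euclideanSpace_fin
  refine ⟨T.isSymmetric_adjoint_comp_self.eigenvectorBasis hn, fun i => ?_⟩
  rw [T.sq_singularValues_fin hn]
  exact T.isSymmetric_adjoint_comp_self.apply_eigenvectorBasis hn i

theorem inner_apply_rightSingularBasis {A : Matrix (Fin m) (Fin n) ℂ}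
    {b : OrthonormalBasis (Fin n) ℂ (EuclideanSpace ℂ (Fin n))}
    (hb : ∀ i, LinearMap.adjoint (Matrix.toEuclideanLin A) (Matrix.toEuclideanLin A (b i))
        = (((Matrix.toEuclideanLin A).singularValues i ^ 2 : ℝ) : ℂ) • b i) (i j : Fin n) :
    inner ℂ (Matrix.toEuclideanLin A (b i)) (Matrix.toEuclideanLin A (b j))
      = if i = j then (((Matrix.toEuclideanLin A).singularValues i ^ 2 : ℝ) : ℂ) else 0 := by
  rw [← LinearMap.adjoint_inner_left, hb, inner_smul_left, Complex.conj_ofReal,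
    orthonormal_iff_ite.1 b.orthonormal, mul_ite, mul_one, mul_zero]

theorem norm_apply_rightSingularBasis {A : Matrix (Fin m) (Fin n) ℂ}
    {b : OrthonormalBasis (Fin n) ℂ (EuclideanSpace ℂ (Fin n))}
    (hb : ∀ i, LinearMap.adjoint (Matrix.toEuclideanLin A) (Matrix.toEuclideanLin A (b i))
        = (((Matrix.toEuclideanLin A).singularValues i ^ 2 : ℝ) : ℂ) • b i) (i : Fin n) :
    ‖Matrix.toEuclideanLin A (b i)‖ = (Matrix.toEuclideanLin A).singularValues i := by
  have h := inner_apply_rightSingularBasis hb i i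
  have h' : ‖Matrix.toEuclideanLin A (b i)‖ ^ 2
      = (Matrix.toEuclideanLin A).singularValues i ^ 2 := by
    rw [← inner_self_eq_norm_sq (𝕜 := ℂ), h, if_pos rfl]
    exact Complex.ofReal_re _
  exact (sq_eq_sq₀ (norm_nonneg _) (LinearMap.singularValues_nonneg _ _)).1 h'

theorem singularValues_eq_zero_of_min_le (A : Matrix (Fin m) (Fin n) ℂ) {i : ℕ}
    (hi : min m n ≤ i) : (Matrix.toEuclideanLin A).singularValues i = 0 := by
  rw [LinearMap.singularValues_eq_zero_iff_le_finrank_range, finrank_range_toEuclideanLin]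
  exact (le_min A.rank_le_height A.rank_le_width).trans hi

/-- The unitary matrix with the vectors of an orthonormal basis as columns. -/
theorem exists_unitary_of_orthonormalBasis
    (b : OrthonormalBasis (Fin n) ℂ (EuclideanSpace ℂ (Fin n))) :
    ∃ U ∈ unitaryGroup (Fin n) ℂ, ∀ i j, U i j = b j i :=
  ⟨(EuclideanSpace.basisFun (Fin n) ℂ).toBasis.toMatrix b,
    (EuclideanSpace.basisFun (Fin n) ℂ).toMatrix_orthonormalBasis_mem_unitary b, fun i j => by
      simp [Module.Basis.toMatrix_apply]⟩

/-- Existence of the singular value decomposition. -/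
theorem exists_isSVD (A : Matrix (Fin m) (Fin n) ℂ) : ∃ V W, IsSVD A V W := by
  obtain ⟨b, hb⟩ := exists_rightSingularBasis A
  have hin := inner_apply_rightSingularBasis hb
  have hnorm := norm_apply_rightSingularBasis hb
  set T := Matrix.toEuclideanLin A with hT
  -- Left singular vectors `σ_i⁻¹ T b_i`. Only those with `σ_i ≠ 0` are used; they are orthonormal
  -- and are completed to a basis.
  let v : Fin m → EuclideanSpace ℂ (Fin m) := fun i =>
    if h : i.val < n then ((T.singularValues i : ℂ))⁻¹ • T (b ⟨i, h⟩) else 0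
  let s : Set (Fin m) := {i | T.singularValues i ≠ 0}
  have hs : ∀ i ∈ s, i.val < n := fun i hi => by
    by_contra h
    exact hi (singularValues_eq_zero_of_min_le A ((min_le_right _ _).trans (not_lt.1 h)))
  have hv : Orthonormal ℂ (s.domRestrict v) := by
    rw [orthonormal_iff_ite]
    rintro ⟨i, hi⟩ ⟨j, hj⟩
    have hi' : (T.singularValues i : ℂ) ≠ 0 := Complex.ofReal_ne_zero.2 hi
    simp only [Set.domRestrict_apply, v, hs i hi, hs j hj, dif_pos, inner_smul_left,
      inner_smul_right, hin, Fin.mk.injEq, Subtype.mk.injEq, Fin.val_inj]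
    split_ifs with hij
    · subst hij
      rw [map_inv₀, Complex.conj_ofReal, Complex.ofReal_pow]
      field_simp
    · simp
  obtain ⟨b', hb'⟩ := hv.exists_orthonormalBasis_extension_of_card_eq (by simp)
  obtain ⟨V, hV, hVb⟩ := exists_unitary_of_orthonormalBasis b'
  obtain ⟨W, hW, hWb⟩ := exists_unitary_of_orthonormalBasis b
  refine ⟨V, W, hV, hW, ?_⟩
  have hAW : A * W = V * sigmaMatrix A := by
    ext i j
    have h1 : (A * W) i j = T (b j) i := by
      rw [hT, toLpLin_apply]
      simp [mul_apply, mulVec, dotProduct, hWb]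
    rw [h1, mul_apply]
    by_cases h0 : T.singularValues j = 0
    · have : T (b j) = 0 := by rw [← norm_eq_zero, hnorm, h0]
      rw [this, Finset.sum_eq_zero]
      · rfl
      · intro k _
        simp only [sigmaMatrix, of_apply]
        split_ifs with hkj
        · rw [hkj, ← hT, h0, Complex.ofReal_zero, mul_zero]
        · rw [mul_zero]
    · have hjm : j.val < m := by
        by_contra h
        exact h0 (singularValues_eq_zero_of_min_le A ((min_le_left _ _).trans (not_lt.1 h)))
      rw [Finset.sum_eq_single ⟨j, hjm⟩]
      · have h2 := hb' ⟨j, hjm⟩ h0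
        have h0' : (T.singularValues j : ℂ) ≠ 0 := Complex.ofReal_ne_zero.2 h0
        rw [hVb, h2]
        simp only [sigmaMatrix, of_apply, if_true, v, Fin.is_lt, dif_pos, Fin.eta,
          PiLp.smul_apply, smul_eq_mul, ← hT]
        field_simp
      · intro k _ hk
        simp only [sigmaMatrix, of_apply]
        rw [if_neg fun h => hk (Fin.ext h), mul_zero]
      · simp
  rw [← hAW, Matrix.mul_assoc, unitary_mul_conjTranspose hW, Matrix.mul_one]

theorem IsSVD.isSingularDecomposition {A : Matrix (Fin m) (Fin n) ℂ}
    {V : Matrix (Fin m) (Fin m) ℂ} {W : Matrix (Fin n) (Fin n) ℂ} (h : IsSVD A V W) :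
    IsSingularDecomposition A (Matrix.toEuclideanLin A).singularValues V W where
  left_mem := h.1
  right_mem := h.2.1
  eq := h.2.2
  antitone := LinearMap.singularValues_antitone _
  nonneg := LinearMap.singularValues_nonneg _
  eq_zero _ hi := singularValues_eq_zero_of_min_le A hi

theorem conjTranspose_mul_self_eq_conjDiagonal {A : Matrix (Fin m) (Fin n) ℂ}
    {V : Matrix (Fin m) (Fin m) ℂ} (hV : V ∈ unitaryGroup (Fin m) ℂ) {W : Matrix (Fin n) (Fin n) ℂ}
    {d : ℕ → ℝ} (h : A = V * rectDiagonal m n d * Wᴴ) :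
    Aᴴ * A = conjDiagonal W fun i => if i.val < m then d i * d i else 0 := by
  have h1 : Aᴴ * A = W * ((rectDiagonal m n d)ᴴ * (Vᴴ * V) * rectDiagonal m n d) * Wᴴ := by
    rw [h]
    simp only [conjTranspose_mul, conjTranspose_conjTranspose, Matrix.mul_assoc]
  rw [h1, unitary_conjTranspose_mul hV, Matrix.mul_one, rectDiagonal_conjTranspose,
    rectDiagonal_mul, rectDiagonal_self, conjDiagonal]

open Polynomial in
theorem charpoly_conjDiagonal {W : Matrix (Fin n) (Fin n) ℂ} (hW : W ∈ unitaryGroup (Fin n) ℂ)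
    (α : Fin n → ℝ) : (conjDiagonal W α).charpoly = ∏ i, (X - C (α i : ℂ)) := by
  rw [conjDiagonal, charpoly_mul_comm, ← Matrix.mul_assoc, unitary_conjTranspose_mul hW,
    Matrix.one_mul, charpoly_diagonal]

/-- The diagonal entries of a real diagonal matrix unitarily equivalent to `A` are, up to order and
signs, the singular values of `A`. -/
theorem exists_perm_abs_eq {A : Matrix (Fin m) (Fin n) ℂ} {V V' : Matrix (Fin m) (Fin m) ℂ}
    {W W' : Matrix (Fin n) (Fin n) ℂ} (hV : V ∈ unitaryGroup (Fin m) ℂ)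
    (hV' : V' ∈ unitaryGroup (Fin m) ℂ) (hW : W ∈ unitaryGroup (Fin n) ℂ)
    (hW' : W' ∈ unitaryGroup (Fin n) ℂ) {d d' : ℕ → ℝ} (h : A = V * rectDiagonal m n d * Wᴴ)
    (h' : A = V' * rectDiagonal m n d' * W'ᴴ) :
    ∃ σ : Equiv.Perm (Fin (min m n)), ∀ i : Fin (min m n), |d i| = |d' (σ i)| := by
  -- The characteristic polynomial of `A* A` has the `min m n` roots `f i ^ 2` and `n - min m n`
  -- extra zeros; cancelling the power of `X` removes the latter.
  have key : ∀ f : ℕ → ℝ, ∏ i : Fin n,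
      (Polynomial.X - Polynomial.C (((if i.val < m then f i * f i else 0 : ℝ)) : ℂ))
      = (∏ i : Fin (min m n), (Polynomial.X - Polynomial.C ((f i * f i : ℝ) : ℂ)))
        * Polynomial.X ^ (n - min m n) := fun f => by
    rw [Fin.prod_univ_eq_prod_range (fun i => Polynomial.X - Polynomial.C
      (((if i < m then f i * f i else 0 : ℝ)) : ℂ)) n, Fin.prod_univ_eq_prod_range (fun i =>
      Polynomial.X - Polynomial.C ((f i * f i : ℝ) : ℂ)) (min m n),
      ← Finset.prod_range_mul_prod_Ico _ (min_le_right m n)]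
    congr 1
    · refine Finset.prod_congr rfl fun i hi => ?_
      rw [if_pos ((Finset.mem_range.1 hi).trans_le (min_le_left _ _))]
    · rw [Finset.prod_congr rfl (g := fun _ => Polynomial.X), Finset.prod_const, Nat.card_Ico]
      intro i hi
      rw [if_neg (by have := Finset.mem_Ico.1 hi; omega)]
      simp
  have h1 := charpoly_conjDiagonal hW fun i => if i.val < m then d i * d i else 0
  rw [← conjTranspose_mul_self_eq_conjDiagonal hV h,
    conjTranspose_mul_self_eq_conjDiagonal hV' h', charpoly_conjDiagonal hW', key, key] at h1
  have h2 := mul_right_cancel₀ (pow_ne_zero _ Polynomial.X_ne_zero) h1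
  have h3 := congrArg Polynomial.roots h2
  have hr : ∀ f : ℕ → ℝ, (∏ i : Fin (min m n),
      (Polynomial.X - Polynomial.C ((f i * f i : ℝ) : ℂ))).roots
      = Multiset.map (fun i : Fin (min m n) => ((f i * f i : ℝ) : ℂ)) Finset.univ.val := fun f => by
    have := Polynomial.roots_multiset_prod_X_sub_C
      (Multiset.map (fun i : Fin (min m n) => ((f i * f i : ℝ) : ℂ)) Finset.univ.val)
    rw [Multiset.map_map] at this
    exact this
  rw [hr, hr] at h3
  obtain ⟨σ, hσ⟩ := exists_equiv_of_multiset_map_eq h3.symm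
  exact ⟨σ, fun i => abs_eq_abs.2 (mul_self_eq_mul_self_iff.1 (Complex.ofReal_injective (hσ i)))⟩

/-- The entries of `d` may be unsorted and of either sign, as happens for `s_i(F) - 1`. -/
theorem IsSymmetricGauge.gaugeNorm_eq {Φ : Seminorm ℝ (Fin (min m n) → ℝ)}
    (hΦ : IsSymmetricGauge Φ) {A : Matrix (Fin m) (Fin n) ℂ} {V : Matrix (Fin m) (Fin m) ℂ}
    {W : Matrix (Fin n) (Fin n) ℂ} (hV : V ∈ unitaryGroup (Fin m) ℂ)
    (hW : W ∈ unitaryGroup (Fin n) ℂ) {d : ℕ → ℝ} (h : A = V * rectDiagonal m n d * Wᴴ) :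
    gaugeNorm Φ A = Φ fun i => d i := by
  obtain ⟨V', W', h'⟩ := exists_isSVD A
  obtain ⟨σ, hσ⟩ := exists_perm_abs_eq h'.1 hV h'.2.1 hW h'.2.2 h
  exact hΦ.map_eq_of_abs_comp_perm σ hσ

end SingularValues

/-! ### Frobenius inner product and von Neumann's trace inequality -/

section Frobenius

variable {m n : ℕ}

/-- The real Frobenius inner product `Re tr(A* B)`. -/
noncomputable def frobeniusInner (A B : Matrix (Fin m) (Fin n) ℂ) : ℝ := (Aᴴ * B).trace.re

theorem frobeniusInner_add_left (A B C : Matrix (Fin m) (Fin n) ℂ) :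
    frobeniusInner (A + B) C = frobeniusInner A C + frobeniusInner B C := by
  simp [frobeniusInner, conjTranspose_add, Matrix.add_mul]

theorem frobeniusInner_sub_left (A B C : Matrix (Fin m) (Fin n) ℂ) :
    frobeniusInner (A - B) C = frobeniusInner A C - frobeniusInner B C := by
  simp [frobeniusInner, conjTranspose_sub, Matrix.sub_mul]

theorem frobeniusInner_comm (A B : Matrix (Fin m) (Fin n) ℂ) :
    frobeniusInner A B = frobeniusInner B A := by
  have : Aᴴ * B = (Bᴴ * A)ᴴ := by rw [conjTranspose_mul, conjTranspose_conjTranspose]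
  rw [frobeniusInner, this, trace_conjTranspose, Complex.star_def, Complex.conj_re, frobeniusInner]

theorem frobeniusInner_add_right (A B C : Matrix (Fin m) (Fin n) ℂ) :
    frobeniusInner A (B + C) = frobeniusInner A B + frobeniusInner A C := by
  simp [frobeniusInner, Matrix.mul_add]

theorem frobeniusInner_sub_right (A B C : Matrix (Fin m) (Fin n) ℂ) :
    frobeniusInner A (B - C) = frobeniusInner A B - frobeniusInner A C := by
  simp [frobeniusInner, Matrix.mul_sub]

theorem frobeniusInner_self_nonneg (A : Matrix (Fin m) (Fin n) ℂ) : 0 ≤ frobeniusInner A A :=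
  (Complex.nonneg_iff.1 (posSemidef_conjTranspose_mul_self A).trace_nonneg).1

theorem eq_zero_of_frobeniusInner_self {A : Matrix (Fin m) (Fin n) ℂ}
    (h : frobeniusInner A A = 0) : A = 0 := by
  refine trace_conjTranspose_mul_self_eq_zero_iff.1 (Complex.ext h ?_)
  exact (Complex.nonneg_iff.1 (posSemidef_conjTranspose_mul_self A).trace_nonneg).2.symm

theorem frobeniusInner_rectDiagonal (d d' : ℕ → ℝ) :
    frobeniusInner (rectDiagonal m n d) (rectDiagonal m n d')
      = ∑ i : Fin (min m n), d i * d' i := by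
  rw [frobeniusInner, rectDiagonal_conjTranspose, rectDiagonal_mul, rectDiagonal_self,
    trace_diagonal, ← Complex.ofReal_sum, Complex.ofReal_re]
  have h := (sum_fin_eq_sum_fin_min (m := m) (n := n)
    (f := fun i => if i < min m n then d i * d' i else 0) fun i hi => if_neg (not_lt.2 hi)).2
  simp only [lt_min_iff, Fin.is_lt, and_true] at h
  rw [h]
  refine Finset.sum_congr rfl fun i _ => if_pos ?_
  have := i.2
  omega

theorem frobeniusInner_unitary_mul {V : Matrix (Fin m) (Fin m) ℂ} {W : Matrix (Fin n) (Fin n) ℂ}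
    (hV : V ∈ unitaryGroup (Fin m) ℂ) (hW : W ∈ unitaryGroup (Fin n) ℂ)
    (A B : Matrix (Fin m) (Fin n) ℂ) :
    frobeniusInner (V * A * Wᴴ) (V * B * Wᴴ) = frobeniusInner A B := by
  have h1 : (V * A * Wᴴ)ᴴ * (V * B * Wᴴ) = W * (Aᴴ * (Vᴴ * V) * B) * Wᴴ := by
    simp only [conjTranspose_mul, conjTranspose_conjTranspose, Matrix.mul_assoc]
  rw [frobeniusInner, h1, unitary_conjTranspose_mul hV, Matrix.mul_one, trace_mul_comm,
    ← Matrix.mul_assoc, unitary_conjTranspose_mul hW, Matrix.one_mul, frobeniusInner]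

theorem frobeniusInner_self_of_eq {A : Matrix (Fin m) (Fin n) ℂ}
    {V : Matrix (Fin m) (Fin m) ℂ} {W : Matrix (Fin n) (Fin n) ℂ}
    (hV : V ∈ unitaryGroup (Fin m) ℂ) (hW : W ∈ unitaryGroup (Fin n) ℂ) {d : ℕ → ℝ}
    (h : A = V * rectDiagonal m n d * Wᴴ) :
    frobeniusInner A A = ∑ i : Fin (min m n), d i ^ 2 := by
  rw [h, frobeniusInner_unitary_mul hV hW, frobeniusInner_rectDiagonal]
  exact Finset.sum_congr rfl fun i _ => (sq _).symm

theorem IsSingularDecomposition.frobeniusInner_self {A : Matrix (Fin m) (Fin n) ℂ}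
    {a : ℕ → ℝ} {V : Matrix (Fin m) (Fin m) ℂ} {W : Matrix (Fin n) (Fin n) ℂ}
    (h : IsSingularDecomposition A a V W) :
    frobeniusInner A A = ∑ i : Fin (min m n), a i ^ 2 :=
  frobeniusInner_self_of_eq h.left_mem h.right_mem h.eq

theorem frobeniusInner_sub_self (A B : Matrix (Fin m) (Fin n) ℂ) :
    frobeniusInner (A - B) (A - B)
      = frobeniusInner A A + frobeniusInner B B - 2 * frobeniusInner A B := by
  rw [frobeniusInner_sub_left, frobeniusInner_sub_right, frobeniusInner_sub_right,
    frobeniusInner_comm B A]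
  ring

/-- Von Neumann's trace inequality. -/
theorem frobeniusInner_le_sum_mul {A B : Matrix (Fin m) (Fin n) ℂ} {a b : ℕ → ℝ}
    {V₁ V₂ : Matrix (Fin m) (Fin m) ℂ} {W₁ W₂ : Matrix (Fin n) (Fin n) ℂ}
    (hA : IsSingularDecomposition A a V₁ W₁) (hB : IsSingularDecomposition B b V₂ W₂) :
    frobeniusInner A B ≤ ∑ i : Fin (min m n), a i * b i := by
  obtain ⟨V, W, hVW⟩ := exists_isSVD (A - B)
  have hC := hVW.isSingularDecomposition
  -- Mirsky in the Frobenius norm: `∑ (a i - b i)² ≤ ‖A - B‖²`. Expanding both sides leaves the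
  -- cross terms.
  have h := sum_sq_le_of_truncated
    (x := fun i : Fin (min m n) => a i - b i)
    (y := fun i : Fin (min m n) => (Matrix.toEuclideanLin (A - B)).singularValues i)
    (fun i j hij => hC.antitone hij) (fun i => hC.nonneg i)
    (fun t ht => sum_truncated_singularValues_sub_le hA hB hC ht)
  rw [← hC.frobeniusInner_self, frobeniusInner_sub_self, hA.frobeniusInner_self,
    hB.frobeniusInner_self] at h
  have h1 : ∑ i : Fin (min m n), (a i - b i) ^ 2 = ∑ i : Fin (min m n), a i ^ 2
      + ∑ i : Fin (min m n), b i ^ 2 - 2 * ∑ i : Fin (min m n), a i * b i := by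
    rw [Finset.mul_sum, ← Finset.sum_add_distrib, ← Finset.sum_sub_distrib]
    exact Finset.sum_congr rfl fun i _ => by ring
  linarith

end Frobenius

/-! ### Partial isometries and the equality case -/

section PartialIsometry

variable {m n k : ℕ}

/-- The singular values of a partial isometry of rank `k`. -/
def indicatorLt (k : ℕ) (i : ℕ) : ℝ := if i < k then 1 else 0

theorem idBlock_eq_rectDiagonal : idBlock m n k = rectDiagonal m n (indicatorLt k) := by
  ext i j
  simp only [idBlock, rectDiagonal_apply, indicatorLt, of_apply, ite_and, apply_ite Complex.ofReal,
    Complex.ofReal_one, Complex.ofReal_zero]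

theorem indicatorLt_mul_self (i : ℕ) : indicatorLt k i * indicatorLt k i = indicatorLt k i := by
  unfold indicatorLt
  split_ifs <;> simp

theorem toEuclideanLin_mul_apply {p : ℕ} (A : Matrix (Fin m) (Fin n) ℂ)
    (B : Matrix (Fin n) (Fin p) ℂ) (f : EuclideanSpace ℂ (Fin p)) :
    Matrix.toEuclideanLin (A * B) f = Matrix.toEuclideanLin A (Matrix.toEuclideanLin B f) := by
  simp [toLpLin_apply, mulVec_mulVec]

theorem isPartialIsometry_of_mul_conjTranspose_mul {X : Matrix (Fin m) (Fin n) ℂ}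
    (h : X * (Xᴴ * X) = X) : IsPartialIsometry X := by
  intro f hf
  -- `f - X* X f` is in the kernel, hence orthogonal to `f`, which reads `‖f‖² = ‖X f‖²`.
  have h1 : f - Matrix.toEuclideanLin (Xᴴ * X) f ∈ LinearMap.ker (Matrix.toEuclideanLin X) := by
    rw [LinearMap.mem_ker, map_sub, ← toEuclideanLin_mul_apply, h, sub_self]
  have h2 := (Submodule.mem_orthogonal' _ _).1 hf _ h1
  rw [inner_sub_right, toEuclideanLin_mul_apply, toEuclideanLin_conjTranspose_eq_adjoint,
    LinearMap.adjoint_inner_right, sub_eq_zero] at h2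
  have h3 := congrArg Complex.re h2
  have h4 : ‖f‖ ^ 2 = ‖Matrix.toEuclideanLin X f‖ ^ 2 := by
    rw [← inner_self_eq_norm_sq (𝕜 := ℂ), ← inner_self_eq_norm_sq (𝕜 := ℂ)]
    exact h3
  exact ((sq_eq_sq₀ (norm_nonneg _) (norm_nonneg _)).1 h4).symm

theorem mem_partialIsometries_of_eq (hk : k ≤ min m n) {V : Matrix (Fin m) (Fin m) ℂ}
    {W : Matrix (Fin n) (Fin n) ℂ} (hV : V ∈ unitaryGroup (Fin m) ℂ)
    (hW : W ∈ unitaryGroup (Fin n) ℂ) :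
    V * rectDiagonal m n (indicatorLt k) * Wᴴ ∈ partialIsometries m n k := by
  set X := V * rectDiagonal m n (indicatorLt k) * Wᴴ with hX
  have hXX := conjTranspose_mul_self_eq_conjDiagonal hV hX
  have hind : (fun i : Fin n => if i.val < m then indicatorLt k i * indicatorLt k i else 0)
      = fun i : Fin n => indicatorLt k i := by
    funext i
    rw [indicatorLt_mul_self]
    exact ite_eq_left_iff.2 fun h => (if_neg (by omega)).symm
  rw [hind] at hXX
  refine ⟨isPartialIsometry_of_mul_conjTranspose_mul ?_, ?_⟩
  · have h1 : X * (Xᴴ * X) = V * (rectDiagonal m n (indicatorLt k) * (Wᴴ * W)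
        * rectDiagonal n n (indicatorLt k)) * Wᴴ := by
      rw [hXX, hX, conjDiagonal, rectDiagonal_self]
      simp only [Matrix.mul_assoc]
    rw [h1, unitary_conjTranspose_mul hW, Matrix.mul_one, rectDiagonal_mul, hX]
    congr 2
    exact rectDiagonal_congr fun i _ h2 => by rw [if_pos h2, indicatorLt_mul_self]
  · have hdet : ∀ U ∈ unitaryGroup (Fin n) ℂ, IsUnit U.det := fun U hU =>
      (Matrix.isUnit_iff_isUnit_det U).1 (Unitary.toUnits ⟨U, hU⟩).isUnit
    have hWc : Wᴴ ∈ unitaryGroup (Fin n) ℂ := Unitary.star_mem hW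
    rw [← rank_conjTranspose_mul_self, hXX, conjDiagonal,
      rank_mul_eq_left_of_isUnit_det _ _ (hdet _ hWc),
      rank_mul_eq_right_of_isUnit_det _ _ (hdet _ hW), rank_diagonal, Fintype.card_subtype]
    have : (Finset.univ.filter fun i : Fin n => ((indicatorLt k i : ℝ) : ℂ) ≠ 0)
        = Finset.univ.filter fun i : Fin n => i.val < k := by
      ext i
      simp [indicatorLt]
    rw [this, Fin.card_filter_val_lt]
    omega

/-- A right singular vector with nonzero singular value is a multiple of a vector in the range of
`X*`, so it lies in `(ker X)ᗮ` and its norm is preserved. The rank counts these vectors. -/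
theorem singularValues_of_mem_partialIsometries {X : Matrix (Fin m) (Fin n) ℂ}
    (hX : X ∈ partialIsometries m n k) (i : ℕ) :
    (Matrix.toEuclideanLin X).singularValues i = indicatorLt k i := by
  obtain ⟨b, hb⟩ := exists_rightSingularBasis X
  have hnorm := norm_apply_rightSingularBasis hb
  have hiff : (Matrix.toEuclideanLin X).singularValues i = 0 ↔ k ≤ i := by
    rw [LinearMap.singularValues_eq_zero_iff_le_finrank_range, finrank_range_toEuclideanLin, hX.2]
  unfold indicatorLt
  split_ifs with hik
  · have h0 : (Matrix.toEuclideanLin X).singularValues i ≠ 0 := fun h => by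
      have := hiff.1 h
      omega
    have hin : i < n := by
      have := hX.2 ▸ X.rank_le_width
      omega
    have hmem : b ⟨i, hin⟩ ∈ (LinearMap.ker (Matrix.toEuclideanLin X))ᗮ := by
      rw [Submodule.mem_orthogonal]
      intro f hf
      have h1 : inner ℂ f (LinearMap.adjoint (Matrix.toEuclideanLin X)
          (Matrix.toEuclideanLin X (b ⟨i, hin⟩))) = 0 := by
        rw [LinearMap.adjoint_inner_right, LinearMap.mem_ker.1 hf, inner_zero_left]
      rw [hb, inner_smul_right] at h1
      exact (mul_eq_zero.1 h1).resolve_left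
        (Complex.ofReal_ne_zero.2 (pow_ne_zero 2 h0))
    rw [← hnorm ⟨i, hin⟩, hX.1 _ hmem]
    exact b.orthonormal.1 _
  · exact hiff.2 (not_lt.1 hik)

theorem exists_isSingularDecomposition_of_mem_partialIsometries {X : Matrix (Fin m) (Fin n) ℂ}
    (hX : X ∈ partialIsometries m n k) :
    ∃ V W, IsSingularDecomposition X (indicatorLt k) V W := by
  obtain ⟨V, W, h⟩ := exists_isSVD X
  have h' := h.isSingularDecomposition
  rw [show ⇑(Matrix.toEuclideanLin X).singularValues = indicatorLt k from
    funext (singularValues_of_mem_partialIsometries hX)] at h'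
  exact ⟨V, W, h'⟩

/-- Equality in von Neumann's trace inequality for a partial isometry forces a simultaneous
singular value decomposition. -/
theorem exists_simultaneous_isSVD {F X : Matrix (Fin m) (Fin n) ℂ}
    {V₁ : Matrix (Fin m) (Fin m) ℂ} {W₁ : Matrix (Fin n) (Fin n) ℂ}
    (hX : IsSingularDecomposition X (indicatorLt k) V₁ W₁)
    (h : frobeniusInner X F = ∑ i : Fin (min m n),
      indicatorLt k i * (Matrix.toEuclideanLin F).singularValues i) :
    ∃ V W, IsSVD F V W ∧ X = V * rectDiagonal m n (indicatorLt k) * Wᴴ := by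
  obtain ⟨V₂, W₂, hF'⟩ := exists_isSVD F
  have hF := hF'.isSingularDecomposition
  set s : ℕ → ℝ := ⇑(Matrix.toEuclideanLin F).singularValues
  set c := indicatorLt k
  obtain ⟨V, W, hG'⟩ := exists_isSVD (F + X)
  have hG := hG'.isSingularDecomposition
  set g : ℕ → ℝ := ⇑(Matrix.toEuclideanLin (F + X)).singularValues
  have hGF := frobeniusInner_le_sum_mul hG hF
  have hGX := frobeniusInner_le_sum_mul hG hX
  -- Equality in the cross term gives `‖F + X‖² = ∑ (s + c)²`, while von Neumann against `F` and `X`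
  -- gives `‖F + X‖² ≤ ∑ g (s + c)`. As `‖F + X‖² = ∑ g²`, this forces `g = s + c`.
  have hGG : frobeniusInner (F + X) (F + X) = ∑ i : Fin (min m n), (s i + c i) ^ 2 := by
    rw [frobeniusInner_add_left, frobeniusInner_add_right, frobeniusInner_add_right,
      frobeniusInner_comm F X, h, hF.frobeniusInner_self, hX.frobeniusInner_self,
      ← Finset.sum_add_distrib, ← Finset.sum_add_distrib, ← Finset.sum_add_distrib]
    exact Finset.sum_congr rfl fun i _ => by ring
  have hgg := hG.frobeniusInner_self
  have hGle : frobeniusInner (F + X) (F + X) ≤ ∑ i : Fin (min m n), g i * (s i + c i) := by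
    rw [frobeniusInner_add_right]
    simp only [mul_add, Finset.sum_add_distrib]
    exact add_le_add hGF hGX
  have hzero : ∑ i : Fin (min m n), (g i - (s i + c i)) ^ 2 ≤ 0 := by
    have : ∑ i : Fin (min m n), (g i - (s i + c i)) ^ 2 = ∑ i : Fin (min m n), g i ^ 2
        + ∑ i : Fin (min m n), (s i + c i) ^ 2 - 2 * ∑ i : Fin (min m n), g i * (s i + c i) := by
      rw [Finset.mul_sum, ← Finset.sum_add_distrib, ← Finset.sum_sub_distrib]
      exact Finset.sum_congr rfl fun i _ => by ring
    linarith
  have hg : ∀ i : Fin (min m n), g i = s i + c i := fun i => by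
    have h1 := (Finset.sum_eq_zero_iff_of_nonneg fun i _ => sq_nonneg _).1
      (le_antisymm hzero (Finset.sum_nonneg fun i _ => sq_nonneg _)) i (Finset.mem_univ i)
    exact sub_eq_zero.1 (pow_eq_zero_iff two_ne_zero |>.1 h1)
  have hrect : rectDiagonal m n g = rectDiagonal m n s + rectDiagonal m n c := by
    rw [rectDiagonal_add]
    exact rectDiagonal_congr fun i h1 h2 => hg ⟨i, lt_min h1 h2⟩
  set F' := V * rectDiagonal m n s * Wᴴ with hF'def
  set X' := V * rectDiagonal m n c * Wᴴ with hX'def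
  have hsum : F + X = F' + X' := by
    rw [hG.eq, hrect, Matrix.mul_add, Matrix.add_mul]
  have hF'dec : IsSingularDecomposition F' s V W :=
    ⟨hG.left_mem, hG.right_mem, rfl, hF.antitone, hF.nonneg, hF.eq_zero⟩
  have hXF' := frobeniusInner_le_sum_mul hX hF'dec
  have hXX := hX.frobeniusInner_self
  have hX'X' : frobeniusInner X' X' = ∑ i : Fin (min m n), c i ^ 2 :=
    frobeniusInner_self_of_eq hG.left_mem hG.right_mem rfl
  have hXsum := congrArg (frobeniusInner X) hsum
  rw [frobeniusInner_add_right, frobeniusInner_add_right, h] at hXsum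
  -- Since `⟨X, F'⟩ ≤ ∑ c s = ⟨X, F⟩`, pairing `F + X = F' + X'` with `X` gives `⟨X, X'⟩ ≥ ‖X‖² =
  -- ‖X'‖²`, so `‖X - X'‖² ≤ 0`.
  have hdiff : X - X' = 0 := by
    refine eq_zero_of_frobeniusInner_self (le_antisymm ?_ (frobeniusInner_self_nonneg _))
    rw [frobeniusInner_sub_self]
    linarith
  have hXeq : X = X' := sub_eq_zero.1 hdiff
  rw [← hXeq] at hsum
  exact ⟨V, W, ⟨hG.left_mem, hG.right_mem, add_right_cancel hsum⟩, hXeq⟩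

end PartialIsometry

/-! ### Characterization of the minimizers -/

theorem mainTheorem2 {m n k : ℕ} (hk : 1 ≤ k) (hkq : k ≤ min m n)
    (F : Matrix (Fin m) (Fin n) ℂ) (Φ : Seminorm ℝ (Fin (min m n) → ℝ))
    (hΦ : IsSymmetricGauge Φ) (hconv : IsStrictlyConvexNorm Φ)
    (X : Matrix (Fin m) (Fin n) ℂ) :
    IsRankMinimizer Φ k F X ↔
      ∃ (V : Matrix (Fin m) (Fin m) ℂ) (W : Matrix (Fin n) (Fin n) ℂ),
        IsSVD F V W ∧ X = V * idBlock m n k * W.conjTranspose := by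
  rw [idBlock_eq_rectDiagonal]
  set s : ℕ → ℝ := ⇑(Matrix.toEuclideanLin F).singularValues
  have hdiff : ∀ V W, IsSVD F V W → F - V * rectDiagonal m n (indicatorLt k) * Wᴴ
      = V * rectDiagonal m n (fun i => s i - indicatorLt k i) * Wᴴ := fun V W h => by
    rw [← rectDiagonal_sub, Matrix.mul_sub, Matrix.sub_mul]
    exact congrArg (· - _) h.2.2
  have hvalue : ∀ V W, IsSVD F V W →
      gaugeNorm Φ (F - V * rectDiagonal m n (indicatorLt k) * Wᴴ)
        = Φ fun i => s i - indicatorLt k i := fun V W h =>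
    hΦ.gaugeNorm_eq h.1 h.2.1 (hdiff V W h)
  obtain ⟨V₀, W₀, h₀⟩ := exists_isSVD F
  have hbound : ∀ Y ∈ partialIsometries m n k,
      (Φ fun i => s i - indicatorLt k i) ≤ gaugeNorm Φ (F - Y) ∧
      (gaugeNorm Φ (F - Y) ≤ (Φ fun i => s i - indicatorLt k i) →
        ∃ σ : Equiv.Perm (Fin (min m n)), ∀ i,
          singVec (F - Y) i = |s (σ i) - indicatorLt k (σ i)|) := fun Y hY => by
    obtain ⟨V₁, W₁, hY'⟩ := exists_isSingularDecomposition_of_mem_partialIsometries hY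
    obtain ⟨V₂, W₂, hD⟩ := exists_isSVD (F - Y)
    have hD' := hD.isSingularDecomposition
    have := hΦ.le_of_truncated (x := fun i : Fin (min m n) => s i - indicatorLt k i)
      (y := singVec (F - Y)) (fun i j hij => hD'.antitone hij) (fun i => hD'.nonneg i)
      (fun t ht => sum_truncated_singularValues_sub_le h₀.isSingularDecomposition hY' hD' ht)
    exact ⟨this.1, this.2 hconv⟩
  constructor
  · rintro ⟨hX, hmin⟩
    obtain ⟨V₁, W₁, hX'⟩ := exists_isSingularDecomposition_of_mem_partialIsometries hX
    have h1 := hmin _ (mem_partialIsometries_of_eq hkq h₀.1 h₀.2.1)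
    rw [hvalue _ _ h₀] at h1
    obtain ⟨σ, hσ⟩ := (hbound X hX).2 h1
    refine exists_simultaneous_isSVD hX' ?_
    obtain ⟨V₂, W₂, hD⟩ := exists_isSVD (F - X)
    have h2 := hD.isSingularDecomposition.frobeniusInner_self
    -- The rearrangement `σ` passes from the gauge norm to the Frobenius norm; expanding `‖F - X‖²`
    -- then yields equality in von Neumann's inequality.
    have h3 : ∑ i : Fin (min m n), (Matrix.toEuclideanLin (F - X)).singularValues i ^ 2
        = ∑ i : Fin (min m n), (s i - indicatorLt k i) ^ 2 := by
      rw [← Equiv.sum_comp σ fun i : Fin (min m n) => (s i - indicatorLt k i) ^ 2]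
      refine Finset.sum_congr rfl fun i _ => ?_
      rw [← sq_abs (s (σ i) - _), ← hσ i]
      rfl
    have h4 : ∑ i : Fin (min m n), (s i - indicatorLt k i) ^ 2 = ∑ i : Fin (min m n), s i ^ 2
        + ∑ i : Fin (min m n), indicatorLt k i ^ 2
        - 2 * ∑ i : Fin (min m n), indicatorLt k i * s i := by
      rw [Finset.mul_sum, ← Finset.sum_add_distrib, ← Finset.sum_sub_distrib]
      exact Finset.sum_congr rfl fun i _ => by ring
    rw [frobeniusInner_sub_self, frobeniusInner_comm F X,
      h₀.isSingularDecomposition.frobeniusInner_self, hX'.frobeniusInner_self, h3, h4] at h2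
    linarith
  · rintro ⟨V, W, hVW, rfl⟩
    refine ⟨mem_partialIsometries_of_eq hkq hVW.1 hVW.2.1, fun Y hY => ?_⟩
    rw [hvalue _ _ hVW]
    exact (hbound Y hY).1
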